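/- For $n\ge 0$ let $\mathcal V_n$ be the real nilpotent Lie algebra with basis $e_1,\dots,e_n$ and brackets $[e_i,e_j]=(j-i)e_{i+j}$ for $i+j\le n$, $[e_i,e_j]=0$ for $i+j>n$. Let $V_n$ be the simply connected Lie group with Lie algebra $\mathcal V_n$, acting on $\mathcal V_n^*$ by the coadjoint representation, and let $x_i$ denote the linear function $\xi\mapsto\xi(e_i)$ on $\mathcal V_n^*$. 1) Let $n=2q+2$, $q\ge 0$. There is a polynomial $F$ in $x_{q+1},\dots,x_{2q+2}$, without constant term, such that $$\frac{\partial F}{\partial x_{q+1}}=x_{2q+2}^{\,q},\qquad \frac{\partial F}{\partial x_{q+m+2}}=-\frac{1}{(2m+2)\,x_{2q+2}}\sum_{l=1}^{m+1}(l+m)\,x_{2q+l-m}\,\frac{\partial F}{\partial x_{q+l}}\quad (0\le m\le q-1).$$ For every such polynomial $F=F_{2q+2}$: $F$ is a Casimir polynomial, i.e. it is constant on every coadjoint orbit in $\mathcal V_n^*$; on the hyperplane $x_{2q+2}=0$ one has $$F=\frac{(-1)^q\prod_{m=0}^{q-1}(2m+1)}{2^q\,(q+1)!}\;x_{2q+1}^{\,q+1};$$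 and the coadjoint orbits on which $x_{2q+2}\ne 0$ are exactly the joint level sets $\{x_{2q+2}=c,\ F=d\}$ with $c,d\in\mathbb R$, $c\ne 0$. 2) Let $n=2q+1$, $q\ge 0$. The coadjoint orbits in $\mathcal V_n^*$ on which $x_{2q+1}\neq 0$ are exactly the hyperplanes $\{x_{2q+1}=c\}$ with $c\in\mathbb R$, $c\ne 0$. 3) Let $n\ge 1$ and identify $\mathcal V_{n-1}^*$ with the hyperplane $\{x_n=0\}\subset\mathcal V_n^*$ by the dual of the quotient homomorphism $\mathcal V_n\to\mathcal V_n/\mathbb R e_n=\mathcal V_{n-1}$. Then the coadjoint orbits in $\mathcal V_n^*$ on which $x_n=0$ are exactly the coadjoint orbits in $\mathcal V_{n-1}^*$. -/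

import Mathlib

/-! The Lie algebras `V n`, their adjoint and coadjoint actions, and the Casimir polynomials. -/

/-- The underlying vector space `ℝⁿ` of the Lie algebra `𝒱ₙ`.  The coordinate with index
`k : Fin n` is the coefficient of the basis vector `e_{k+1}`. -/
def V (n : ℕ) : Type := Fin n → ℝ

namespace V

noncomputable instance (n : ℕ) : AddCommGroup (V n) := inferInstanceAs (AddCommGroup (Fin n → ℝ))

noncomputable instance (n : ℕ) : Module ℝ (V n) := inferInstanceAs (Module ℝ (Fin n → ℝ))

noncomputable instance (n : ℕ) : Module ℚ (V n) := inferInstanceAs (Module ℚ (Fin n → ℝ))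

/-- The basis vector `e_i`, `1 ≤ i ≤ n`; by convention `e_i = 0` for all other `i`. -/
noncomputable def e (n i : ℕ) : V n := fun k => if (k : ℕ) + 1 = i then 1 else 0

/-- The bracket of `∑ aᵢ eᵢ` and `∑ bⱼ eⱼ`: the coefficient of `e_k` is the sum of
`(j - i) aᵢ bⱼ` over all `i, j` with `i + j = k`. -/
noncomputable instance (n : ℕ) : Bracket (V n) (V n) where
  bracket a b := fun k => ∑ i : Fin n, ∑ j : Fin n,
    if ((i : ℕ) + 1) + ((j : ℕ) + 1) = (k : ℕ) + 1 then ((j : ℝ) - (i : ℝ)) * a i * b j else 0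

theorem add_apply {n : ℕ} (a b : V n) (k : Fin n) : (a + b) k = a k + b k := rfl

theorem smul_apply {n : ℕ} (t : ℝ) (a : V n) (k : Fin n) : (t • a) k = t * a k := rfl

theorem zero_apply {n : ℕ} (k : Fin n) : (0 : V n) k = 0 := rfl

theorem lie_apply {n : ℕ} (a b : V n) (k : Fin n) :
    ⁅a, b⁆ k = ∑ i : Fin n, ∑ j : Fin n,
      if ((i : ℕ) + 1) + ((j : ℕ) + 1) = (k : ℕ) + 1
      then ((j : ℝ) - (i : ℝ)) * a i * b j else 0 := rfl

@[ext] theorem ext {n : ℕ} {a b : V n} (h : ∀ k, a k = b k) : a = b := funext h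

theorem sum_aux {n : ℕ} (i j l k : Fin n) (r : ℝ) :
    (∑ m : Fin n, if ((i : ℕ) + 1) + ((m : ℕ) + 1) = (k : ℕ) + 1 then
      (if ((j : ℕ) + 1) + ((l : ℕ) + 1) = (m : ℕ) + 1 then ((m : ℝ) - (i : ℝ)) * r else 0) else 0)
    = if (i : ℕ) + j + l + 2 = k then ((j : ℝ) + l + 1 - i) * r else 0 := by
  split_ifs with h
  · have hm : (j : ℕ) + l + 1 < n := by have := k.2; omega
    rw [Finset.sum_eq_single (⟨(j : ℕ) + l + 1, hm⟩ : Fin n)]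
    · rw [if_pos (by simp only; omega), if_pos (by simp only; omega)]
      push_cast
      rfl
    · intro m _ hne
      rw [ite_eq_right_iff]
      intro _
      rw [if_neg]
      intro h3
      exact hne (Fin.ext (by simp only; omega))
    · simp
  · refine Finset.sum_eq_zero fun m _ => ?_
    split_ifs <;> first | rfl | (exfalso; omega)

theorem lie_lie_apply {n : ℕ} (a b c : V n) (k : Fin n) :
    ⁅a, ⁅b, c⁆⁆ k = ∑ i : Fin n, ∑ j : Fin n, ∑ l : Fin n,
      if (i : ℕ) + j + l + 2 = k
      then ((j : ℝ) + l + 1 - i) * (((l : ℝ) - j) * (a i * b j * c l)) else 0 := by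
  rw [lie_apply]
  refine Finset.sum_congr rfl fun i _ => ?_
  simp_rw [← sum_aux, lie_apply, Finset.mul_sum]
  have : ∀ m : Fin n, (if ((i : ℕ) + 1) + ((m : ℕ) + 1) = (k : ℕ) + 1 then
      (∑ j : Fin n, ∑ l : Fin n, ((m : ℝ) - i) * a i *
        (if ((j : ℕ) + 1) + ((l : ℕ) + 1) = (m : ℕ) + 1
          then ((l : ℝ) - j) * b j * c l else 0)) else 0)
      = ∑ j : Fin n, ∑ l : Fin n, if ((i : ℕ) + 1) + ((m : ℕ) + 1) = (k : ℕ) + 1 then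
        (if ((j : ℕ) + 1) + ((l : ℕ) + 1) = (m : ℕ) + 1
          then ((m : ℝ) - i) * (((l : ℝ) - j) * (a i * b j * c l)) else 0) else 0 := by
    intro m
    by_cases h : ((i : ℕ) + 1) + ((m : ℕ) + 1) = (k : ℕ) + 1
    · simp only [h, if_true]
      refine Finset.sum_congr rfl fun j _ => Finset.sum_congr rfl fun l _ => ?_
      split_ifs
      · ring
      · ring
    · simp [h]
  simp_rw [this]
  rw [Finset.sum_comm]
  refine Finset.sum_congr rfl fun j _ => ?_
  rw [Finset.sum_comm]

theorem lie_skew_aux {n : ℕ} (a b : V n) : ⁅a, b⁆ = -⁅b, a⁆ := by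
  ext k
  change _ = -(⁅b, a⁆ k)
  rw [lie_apply, lie_apply, Finset.sum_comm, ← Finset.sum_neg_distrib]
  refine Finset.sum_congr rfl fun i _ => ?_
  rw [← Finset.sum_neg_distrib]
  refine Finset.sum_congr rfl fun j _ => ?_
  rw [show ((j : ℕ) + 1) + ((i : ℕ) + 1) = ((i : ℕ) + 1) + ((j : ℕ) + 1) by ring]
  split_ifs
  · ring
  · simp

theorem lie_add_aux {n : ℕ} (a b c : V n) : ⁅a, b + c⁆ = ⁅a, b⁆ + ⁅a, c⁆ := by
  ext k
  simp only [lie_apply, add_apply, ← Finset.sum_add_distrib]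
  refine Finset.sum_congr rfl fun i _ => Finset.sum_congr rfl fun j _ => ?_
  split_ifs
  · ring
  · simp

theorem lie_smul_aux {n : ℕ} (t : ℝ) (a b : V n) : ⁅a, t • b⁆ = t • ⁅a, b⁆ := by
  ext k
  simp only [lie_apply, smul_apply, Finset.mul_sum]
  refine Finset.sum_congr rfl fun i _ => Finset.sum_congr rfl fun j _ => ?_
  split_ifs
  · ring
  · simp

theorem jacobi_aux {n : ℕ} (a b c : V n) : ⁅a, ⁅b, c⁆⁆ = ⁅⁅a, b⁆, c⁆ + ⁅b, ⁅a, c⁆⁆ := by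
  rw [lie_skew_aux ⁅a, b⁆ c]
  ext k
  change ⁅a, ⁅b, c⁆⁆ k = -(⁅c, ⁅a, b⁆⁆ k) + ⁅b, ⁅a, c⁆⁆ k
  have h2 : ⁅c, ⁅a, b⁆⁆ k = ∑ i : Fin n, ∑ j : Fin n, ∑ l : Fin n,
      if (i : ℕ) + j + l + 2 = k
      then ((i : ℝ) + j + 1 - l) * (((j : ℝ) - i) * (a i * b j * c l)) else 0 := by
    rw [lie_lie_apply, Finset.sum_comm]
    refine Finset.sum_congr rfl fun i _ => ?_
    rw [Finset.sum_comm]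
    refine Finset.sum_congr rfl fun j _ => Finset.sum_congr rfl fun l _ => ?_
    rw [show (l : ℕ) + i + j + 2 = i + j + l + 2 by ring]
    split_ifs
    · ring
    · rfl
  have h3 : ⁅b, ⁅a, c⁆⁆ k = ∑ i : Fin n, ∑ j : Fin n, ∑ l : Fin n,
      if (i : ℕ) + j + l + 2 = k
      then ((i : ℝ) + l + 1 - j) * (((l : ℝ) - i) * (a i * b j * c l)) else 0 := by
    rw [lie_lie_apply, Finset.sum_comm]
    refine Finset.sum_congr rfl fun i _ =>
      Finset.sum_congr rfl fun j _ => Finset.sum_congr rfl fun l _ => ?_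
    rw [show (j : ℕ) + i + l + 2 = i + j + l + 2 by ring]
    split_ifs
    · ring
    · rfl
  rw [h2, h3, lie_lie_apply]
  simp only [← Finset.sum_neg_distrib, ← Finset.sum_add_distrib]
  refine Finset.sum_congr rfl fun i _ =>
    Finset.sum_congr rfl fun j _ => Finset.sum_congr rfl fun l _ => ?_
  split_ifs
  · ring
  · simp

noncomputable instance (n : ℕ) : LieRing (V n) where
  add_lie a b c := by
    rw [lie_skew_aux, lie_add_aux, lie_skew_aux c a, lie_skew_aux c b]; abel
  lie_add := lie_add_aux
  lie_self a := by
    have h := lie_skew_aux a a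
    ext k
    have hk : ⁅a, a⁆ k = -(⁅a, a⁆ k) := congrFun h k
    rw [zero_apply]
    linarith
  leibniz_lie := jacobi_aux

noncomputable instance (n : ℕ) : LieAlgebra ℝ (V n) where
  lie_smul := lie_smul_aux

/-- The defining commutation relations of `𝒱ₙ`: `[eᵢ, eⱼ] = (j - i) e_{i+j}`, which is `0` for
`i + j > n`. -/
theorem lie_e (n i j : ℕ) (hi : 1 ≤ i) (hj : 1 ≤ j) :
    ⁅e n i, e n j⁆ = ((j : ℝ) - (i : ℝ)) • e n (i + j) := by
  ext k
  rw [smul_apply, lie_apply]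
  by_cases h : (k : ℕ) + 1 = i + j
  · have hi' : i - 1 < n := by have := k.2; omega
    have hj' : j - 1 < n := by have := k.2; omega
    rw [Finset.sum_eq_single (⟨i - 1, hi'⟩ : Fin n), Finset.sum_eq_single (⟨j - 1, hj'⟩ : Fin n)]
    · rw [if_pos (by simp only; omega)]
      simp only [e]
      rw [if_pos (by omega), if_pos (by omega), if_pos h]
      push_cast [Nat.cast_sub hi, Nat.cast_sub hj]
      ring
    · intro m _ hne
      have : ¬ ((m : ℕ) + 1 = j) := fun h' => hne (Fin.ext (by simp only; omega))
      simp [e, this]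
    · simp
    · intro m _ hne
      have : ¬ ((m : ℕ) + 1 = i) := fun h' => hne (Fin.ext (by simp only; omega))
      simp [e, this]
    · simp
  · have : e n (i + j) k = 0 := by simp [e, h]
    rw [this, mul_zero]
    refine Finset.sum_eq_zero fun a _ => Finset.sum_eq_zero fun b _ => ?_
    simp only [e]
    split_ifs <;> first | (exfalso; omega) | simp

/-- Every operator `ad X` on `𝒱ₙ` is nilpotent, so that its exponential is a finite sum. -/
theorem isNilpotent_ad (n : ℕ) (X : V n) : IsNilpotent (LieAlgebra.ad ℝ (V n) X) := by
  have key : ∀ (p : ℕ) (Y : V n) (k : Fin n), (k : ℕ) < p →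
      ((LieAlgebra.ad ℝ (V n) X ^ p) Y) k = 0 := by
    intro p
    induction p with
    | zero => intro Y k hk; omega
    | succ p ih =>
      intro Y k hk
      rw [pow_succ', Module.End.mul_apply, LieAlgebra.ad_apply, lie_apply]
      refine Finset.sum_eq_zero fun i _ => Finset.sum_eq_zero fun j _ => ?_
      split_ifs with h
      · rw [ih Y j (by omega), mul_zero]
      · rfl
  refine ⟨n, LinearMap.ext fun Y => V.ext fun k => ?_⟩
  rw [key n Y k k.2]
  rfl

/-- The adjoint group `Ad(Vₙ) ⊆ GL(𝒱ₙ)` of the simply connected nilpotent Lie group `Vₙ` with Lie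
algebra `𝒱ₙ`: it is generated by the operators `Ad(exp X) = e^{ad X}` with `X ∈ 𝒱ₙ`.
(`Vₙ` is the set `𝒱ₙ` with the Campbell-Hausdorff product, and then `exp` is the identity map.) -/
noncomputable def adjointGroup (n : ℕ) : Subgroup (LinearMap.GeneralLinearGroup ℝ (V n)) :=
  Subgroup.closure {g | ∃ X : V n,
    (g : Module.End ℝ (V n)) = IsNilpotent.exp (LieAlgebra.ad ℝ (V n) X)}

/-- The adjoint representation on `𝒱ₙ`. -/
noncomputable def adjointRep (n : ℕ) : Representation ℝ (adjointGroup n) (V n) :=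
  (Units.coeHom (Module.End ℝ (V n))).comp (adjointGroup n).subtype

/-- The coadjoint representation on `𝒱ₙ*`: an element `g` sends `ξ` to `ξ ∘ Ad(g⁻¹)`. -/
noncomputable def coadjointRep (n : ℕ) :
    Representation ℝ (adjointGroup n) (Module.Dual ℝ (V n)) :=
  (adjointRep n).dual

/-- The orbit of `ξ ∈ 𝒱ₙ*` under the coadjoint representation. -/
noncomputable def coadjointOrbit (n : ℕ) (ξ : Module.Dual ℝ (V n)) : Set (Module.Dual ℝ (V n)) :=
  Set.range fun g : adjointGroup n => coadjointRep n g ξ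

/-- The coordinate function `x_i` on `𝒱ₙ*`, that is, `e_i ∈ 𝒱ₙ` as a linear function on `𝒱ₙ*`. -/
noncomputable def x (n i : ℕ) (ξ : Module.Dual ℝ (V n)) : ℝ := ξ (e n i)

/-- The value at `ξ ∈ 𝒱ₙ*` of a polynomial in the coordinate functions `x_1, x_2, …`. -/
noncomputable def evalDual (n : ℕ) (F : MvPolynomial ℕ ℝ) (ξ : Module.Dual ℝ (V n)) : ℝ :=
  MvPolynomial.eval (fun i => x n i ξ) F

/-- A polynomial is a Casimir polynomial of `𝒱ₙ` if it is invariant under the coadjoint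
representation. -/
def IsCasimir (n : ℕ) (F : MvPolynomial ℕ ℝ) : Prop :=
  ∀ ξ : Module.Dual ℝ (V n), ∀ η ∈ coadjointOrbit n ξ, evalDual n F η = evalDual n F ξ

/-- `IsF q F` says that `F` is (a choice of) the polynomial `F_{2q+2}`: a polynomial in
`x_{q+1}, …, x_{2q+2}` without constant term, whose partial derivatives in
`x_{q+1}, …, x_{2q+1}` are given by the recursion
`∂F/∂x_{q+1} = x_{2q+2}^q`,
`∂F/∂x_{q+m+2} = -(1 / ((2m+2) x_{2q+2})) ∑_{l=1}^{m+1} (l+m) x_{2q+l-m} ∂F/∂x_{q+l}`, `0 ≤ m < q`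
(written here without the denominator).  Such an `F` is determined up to a polynomial in
`x_{2q+2}`. -/
structure IsF (q : ℕ) (F : MvPolynomial ℕ ℝ) : Prop where
  vars_subset : F.vars ⊆ Finset.Icc (q + 1) (2 * q + 2)
  constantCoeff_eq : MvPolynomial.constantCoeff F = 0
  pderiv_first : MvPolynomial.pderiv (q + 1) F = MvPolynomial.X (2 * q + 2) ^ q
  pderiv_next : ∀ m < q,
    MvPolynomial.C (2 * (m : ℝ) + 2) * MvPolynomial.X (2 * q + 2) *
        MvPolynomial.pderiv (q + m + 2) F =
      -∑ l ∈ Finset.Icc 1 (m + 1), MvPolynomial.C ((l : ℝ) + (m : ℝ)) *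
        MvPolynomial.X (2 * q + l - m) * MvPolynomial.pderiv (q + l) F

/-- Forgetting the coefficient of `e_{n+1}`. -/
def trunc {n : ℕ} (a : V (n + 1)) : V n := fun k => a k.castSucc

/-- The quotient homomorphism `𝒱ₙ₊₁ → 𝒱ₙ₊₁ / ℝ e_{n+1} = 𝒱ₙ`. -/
noncomputable def proj (n : ℕ) : V (n + 1) →ₗ⁅ℝ⁆ V n where
  toFun := trunc
  map_add' _ _ := rfl
  map_smul' _ _ := rfl
  map_lie' := by
    intro a b
    ext k
    change ⁅a, b⁆ k.castSucc = ⁅trunc a, trunc b⁆ k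
    rw [lie_apply, lie_apply, Fin.sum_univ_castSucc]
    have h0 : (∑ j : Fin (n + 1), if ((Fin.last n : ℕ) + 1) + ((j : ℕ) + 1) = (k.castSucc : ℕ) + 1
        then ((j : ℝ) - ((Fin.last n : Fin (n + 1)) : ℝ)) * a (Fin.last n) * b j else 0) = 0 := by
      refine Finset.sum_eq_zero fun j _ => if_neg ?_
      have := k.2
      simp only [Fin.val_last, Fin.val_castSucc]
      omega
    rw [h0, add_zero]
    refine Finset.sum_congr rfl fun i _ => ?_
    rw [Fin.sum_univ_castSucc, if_neg, add_zero]
    · rfl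
    · have := k.2
      simp only [Fin.val_last, Fin.val_castSucc]
      omega

/-- The embedding `𝒱ₙ* → 𝒱ₙ₊₁*` dual to the quotient homomorphism; it identifies `𝒱ₙ*` with
the hyperplane `x_{n+1} = 0`. -/
noncomputable def embDual (n : ℕ) : Module.Dual ℝ (V n) →ₗ[ℝ] Module.Dual ℝ (V (n + 1)) :=
  LinearMap.dualMap (proj n : V (n + 1) →ₗ[ℝ] V n)

end V

/-! Put `a = x_{2q+2}`, `P = ∑_{k ≤ q} x_{2q+1-k} t^{k+1}` and `Q = a + P`. A solution `F` is the
coefficient of `t^{q+1}` in the expansion of `2 a^{q+1} ((1 + P/a)^{1/2} - 1)`, truncated so that no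
denominators occur (`residue`). Its derivative in `x_{q+1+s}` is the coefficient of `t^s` in the
truncation `D` of `a^q (1 + P/a)^{-1/2}`, and the recursion is the equation `2 Q D' + Q' D = 0` read
coefficientwise (`invSqrtSeries_ode`, `isF_residue`).

For any solution, the recursion with `m = q - i` says that the vector field of `e_i` annihilates
`F`, which suffices for invariance (`isCasimir_of_sum_eq_zero`). Two solutions differ by a
polynomial in `x_{2q+2}` without constant term, so on `x_{2q+2} = 0` it is enough to evaluate
`residue`.

If `x_n ≠ 0`, the transformations `e^{t ad e_i}`, taken for increasing `i`, remove `x_{n-i}` unless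
`2i = n`. For odd `n` only the invariant `x_n` is left. For `n = 2q+2` the coordinate `x_{q+1}` is
left too, and `F` determines it, because `F = x_n^q x_{q+1} + G` with `G` free of `x_{q+1}`. On `x_n
= 0` the action factors through the quotient algebra, whose adjoint group is the image of that of
`𝒱ₙ`. -/

namespace MvPolynomial

/-! ### Partial derivatives of multivariate polynomials -/

variable {σ R : Type*} [CommRing R]

/-- A monomial with exponent `d i > 0` contributes `d i` times its coefficient to the derivative,
and distinct monomials cannot cancel. -/
theorem notMem_vars_of_pderiv_eq_zero [IsDomain R] [CharZero R] {i : σ} {p : MvPolynomial σ R}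
    (h : pderiv i p = 0) : i ∉ p.vars := by
  classical
  rw [mem_vars_iff_mem_support]
  rintro ⟨d, hd, hi⟩
  have hdi : d i ≠ 0 := Finsupp.mem_support_iff.mp hi
  have hle : Finsupp.single i 1 ≤ d := by
    rw [Finsupp.single_le_iff]
    omega
  have hc := coeff_pderiv p (d - Finsupp.single i 1) (i := i)
  rw [h, coeff_zero, tsub_add_cancel_of_le hle] at hc
  rcases mul_eq_zero.mp hc.symm with h0 | h0
  · exact mem_support_iff.mp hd h0
  · exact Nat.cast_add_one_ne_zero _ h0

theorem eval_eq_of_vars {f g : σ → R} {p : MvPolynomial σ R} (h : ∀ i ∈ p.vars, f i = g i) :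
    eval f p = eval g p :=
  eval₂Hom_congr' rfl (fun i hi _ => h i hi) rfl

/-- The Leibniz rule for differentiating a series in `t` coefficient by coefficient; the hypotheses
make `A'` and `B'` the coefficientwise derivatives. -/
theorem pderiv_coeff_mul {i : σ} {A B A' B' : Polynomial (MvPolynomial σ R)}
    (hA : ∀ s, pderiv i (A.coeff s) = A'.coeff s) (hB : ∀ s, pderiv i (B.coeff s) = B'.coeff s)
    (s : ℕ) : pderiv i ((A * B).coeff s) = (A' * B + A * B').coeff s := by
  simp only [Polynomial.coeff_add, Polynomial.coeff_mul, map_sum, ← Finset.sum_add_distrib]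
  refine Finset.sum_congr rfl fun d _ => ?_
  rw [pderiv_mul, hA, hB]

theorem pderiv_coeff_pow_succ {i : σ} {A A' : Polynomial (MvPolynomial σ R)}
    (hA : ∀ s, pderiv i (A.coeff s) = A'.coeff s) (j s : ℕ) :
    pderiv i ((A ^ (j + 1)).coeff s) = (((j : ℕ) + 1) * A ^ j * A').coeff s := by
  induction j generalizing s with
  | zero => simp [hA]
  | succ j ih =>
    rw [pow_succ A (j + 1), pderiv_coeff_mul ih hA]
    congr 1
    push_cast
    ring

/-- The chain rule for a polynomial along a differentiable path. -/
theorem hasDerivAt_eval {σ : Type*} {u : ℝ → σ → ℝ} {u' : σ → ℝ} {t : ℝ} {S : Finset σ}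
    (hu : ∀ j, HasDerivAt (fun r => u r j) (u' j) t) (hS : ∀ j ∉ S, u' j = 0)
    (p : MvPolynomial σ ℝ) :
    HasDerivAt (fun r => eval (u r) p) (∑ j ∈ S, u' j * eval (u t) (pderiv j p)) t := by
  classical
  induction p using MvPolynomial.induction_on with
  | C a => simpa using hasDerivAt_const t a
  | add p q hp hq =>
    simpa only [map_add, mul_add, Finset.sum_add_distrib] using hp.fun_add hq
  | mul_X p i hp =>
    have h := hp.fun_mul (hu i)
    simp only [map_mul, eval_X]
    refine h.congr_deriv ?_
    have hi : ∑ j ∈ S, u' j * (eval (u t) p * eval (u t) (pderiv j (X i))) =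
        eval (u t) p * u' i := by
      have h1 : ∀ j ∈ S, u' j * (eval (u t) p * eval (u t) (pderiv j (X i))) =
          if i = j then eval (u t) p * u' i else 0 := by
        intro j _
        rw [pderiv_X]
        by_cases hij : i = j
        · subst hij; simp [mul_comm]
        · simp [hij]
      rw [Finset.sum_congr rfl h1, Finset.sum_ite_eq]
      split_ifs with h2
      · rfl
      · rw [hS i h2, mul_zero]
    rw [← hi, Finset.sum_mul, ← Finset.sum_add_distrib]
    refine Finset.sum_congr rfl fun j _ => ?_
    rw [pderiv_mul, map_add, map_mul, map_mul, eval_X]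
    ring

end MvPolynomial

namespace V

/-! ### Bases, dual functionals and exponentials -/

theorem sum_apply {n : ℕ} {ι : Type*} (s : Finset ι) (f : ι → V n) (k : Fin n) :
    (∑ i ∈ s, f i) k = ∑ i ∈ s, f i k :=
  map_sum (⟨⟨fun v : V n => v k, rfl⟩, fun _ _ => rfl⟩ : V n →+ ℝ) f s

theorem eq_sum_smul_e {n : ℕ} (v : V n) : v = ∑ i : Fin n, v i • e n (i + 1) := by
  ext k
  rw [sum_apply, Finset.sum_eq_single k]
  · rw [smul_apply]
    simp [e]
  · intro i _ hi
    have : (k : ℕ) ≠ i := fun h => hi (Fin.ext h.symm)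
    rw [smul_apply]
    simp [e, this]
  · simp

theorem e_eq_zero {n i : ℕ} (h : i = 0 ∨ n < i) : e n i = 0 := by
  ext k
  rw [zero_apply, e, if_neg]
  omega

theorem ext_dual {n : ℕ} {ξ η : Module.Dual ℝ (V n)}
    (h : ∀ i, 1 ≤ i → i ≤ n → ξ (e n i) = η (e n i)) : ξ = η := by
  refine LinearMap.ext fun v => ?_
  rw [eq_sum_smul_e v, map_sum, map_sum]
  refine Finset.sum_congr rfl fun i _ => ?_
  rw [map_smul, map_smul, h _ (by omega) (by omega)]

/-- The functional on `𝒱ₙ` taking prescribed values on the basis vectors. -/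
noncomputable def dualOf (n : ℕ) (f : ℕ → ℝ) : Module.Dual ℝ (V n) where
  toFun v := ∑ i : Fin n, v i * f (i + 1)
  map_add' v w := by
    simp only [add_apply, add_mul, Finset.sum_add_distrib]
  map_smul' t v := by
    simp only [smul_apply, mul_assoc, Finset.mul_sum, smul_eq_mul, RingHom.id_apply]

theorem dualOf_e {n i : ℕ} (f : ℕ → ℝ) (h : 1 ≤ i) (h' : i ≤ n) : dualOf n f (e n i) = f i := by
  change ∑ k : Fin n, e n i k * f (k + 1) = f i
  rw [Finset.sum_eq_single ⟨i - 1, by omega⟩]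
  · simp [e, Nat.sub_add_cancel h]
  · intro k _ hk
    have : (k : ℕ) + 1 ≠ i := fun h => hk (Fin.ext (by simp only; omega))
    simp [e, this]
  · simp

theorem exp_ad_apply {n N : ℕ} {X : V n} (hN : LieAlgebra.ad ℝ (V n) X ^ N = 0) (v : V n) :
    IsNilpotent.exp (LieAlgebra.ad ℝ (V n) X) v =
      ∑ k ∈ Finset.range N, ((k.factorial : ℝ)⁻¹) • (LieAlgebra.ad ℝ (V n) X ^ k) v := by
  rw [IsNilpotent.exp_eq_sum hN, LinearMap.sum_apply]
  refine Finset.sum_congr rfl fun k _ => ?_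
  rw [LinearMap.smul_apply, ← Rat.cast_smul_eq_qsmul ℝ]
  push_cast
  rfl

theorem exp_ad_eq_self {n : ℕ} {X v : V n} (h : ⁅X, v⁆ = 0) :
    IsNilpotent.exp (LieAlgebra.ad ℝ (V n) X) v = v := by
  obtain ⟨N, hN⟩ := isNilpotent_ad n X
  rw [exp_ad_apply (pow_eq_zero_of_le N.le_succ hN), Finset.sum_range_succ']
  rw [Finset.sum_eq_zero]
  · simp
  · intro k _
    rw [pow_succ, Module.End.mul_apply, LieAlgebra.ad_apply, h, map_zero, smul_zero]

theorem exp_ad_eq_add {n : ℕ} {X v : V n} (h : ⁅X, ⁅X, v⁆⁆ = 0) :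
    IsNilpotent.exp (LieAlgebra.ad ℝ (V n) X) v = v + ⁅X, v⁆ := by
  obtain ⟨N, hN⟩ := isNilpotent_ad n X
  rw [exp_ad_apply (pow_eq_zero_of_le (N.le_add_right 2) hN), Finset.sum_range_succ',
    Finset.sum_range_succ', Finset.sum_eq_zero]
  · simp [add_comm]
  · intro k _
    rw [pow_succ, pow_succ, Module.End.mul_apply, Module.End.mul_apply, LieAlgebra.ad_apply,
      LieAlgebra.ad_apply, h, map_zero, smul_zero]

theorem exists_mem_adjointGroup {n : ℕ} (X : V n) : ∃ g ∈ adjointGroup n,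
    (g : Module.End ℝ (V n)) = IsNilpotent.exp (LieAlgebra.ad ℝ (V n) X) := by
  obtain ⟨g, hg⟩ := IsNilpotent.isUnit_exp (isNilpotent_ad n X)
  exact ⟨g, Subgroup.subset_closure ⟨X, hg⟩, hg⟩

/-! ### Coadjoint orbits -/

/-- The inverse in the dual representation is harmless, since `g` ranges over a group. -/
theorem mem_coadjointOrbit {n : ℕ} {ξ η : Module.Dual ℝ (V n)} :
    η ∈ coadjointOrbit n ξ ↔
      ∃ g ∈ adjointGroup n, η = ξ.comp (g : Module.End ℝ (V n)) := by
  constructor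
  · rintro ⟨g, rfl⟩
    exact ⟨_, g⁻¹.2, rfl⟩
  · rintro ⟨g, hg, rfl⟩
    refine ⟨⟨g, hg⟩⁻¹, ?_⟩
    change ξ.comp ((((⟨g, hg⟩ : adjointGroup n)⁻¹⁻¹ : adjointGroup n) :
      LinearMap.GeneralLinearGroup ℝ (V n)) : Module.End ℝ (V n)) = _
    rw [inv_inv]

theorem self_mem_coadjointOrbit {n : ℕ} (ξ : Module.Dual ℝ (V n)) : ξ ∈ coadjointOrbit n ξ :=
  mem_coadjointOrbit.mpr ⟨1, one_mem _, rfl⟩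

theorem coadjointOrbit_trans {n : ℕ} {ξ η ζ : Module.Dual ℝ (V n)}
    (h : η ∈ coadjointOrbit n ξ) (h' : ζ ∈ coadjointOrbit n η) : ζ ∈ coadjointOrbit n ξ := by
  obtain ⟨g, hg, rfl⟩ := mem_coadjointOrbit.mp h
  obtain ⟨k, hk, rfl⟩ := mem_coadjointOrbit.mp h'
  exact mem_coadjointOrbit.mpr ⟨g * k, mul_mem hg hk, rfl⟩

theorem coadjointOrbit_symm {n : ℕ} {ξ η : Module.Dual ℝ (V n)}
    (h : η ∈ coadjointOrbit n ξ) : ξ ∈ coadjointOrbit n η := by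
  obtain ⟨g, hg, rfl⟩ := mem_coadjointOrbit.mp h
  refine mem_coadjointOrbit.mpr ⟨g⁻¹, inv_mem hg, ?_⟩
  change ξ = ξ.comp ((g : Module.End ℝ (V n)) * ((g⁻¹ : LinearMap.GeneralLinearGroup ℝ (V n)) :
    Module.End ℝ (V n)))
  rw [← Units.val_mul, mul_inv_cancel]
  rfl

theorem comp_exp_ad_mem_coadjointOrbit {n : ℕ} (ξ : Module.Dual ℝ (V n)) (X : V n) :
    ξ.comp (IsNilpotent.exp (LieAlgebra.ad ℝ (V n) X)) ∈ coadjointOrbit n ξ := by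
  obtain ⟨g, hg, h⟩ := exists_mem_adjointGroup X
  exact mem_coadjointOrbit.mpr ⟨g, hg, by rw [h]⟩

/-! ### Infinitesimal invariance -/

/-- The path `t ↦ ξ ∘ e^{t ad X}`, evaluated at a vector. -/
theorem hasDerivAt_sum_ad_pow {n N : ℕ} {X : V n} (hN : LieAlgebra.ad ℝ (V n) X ^ N = 0)
    (ξ : Module.Dual ℝ (V n)) (v : V n) (t : ℝ) :
    HasDerivAt
      (fun r : ℝ => ∑ k ∈ Finset.range (N + 1),
        r ^ k * ((k.factorial : ℝ)⁻¹ * ξ ((LieAlgebra.ad ℝ (V n) X ^ k) v)))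
      (∑ k ∈ Finset.range (N + 1),
        t ^ k * ((k.factorial : ℝ)⁻¹ * ξ ((LieAlgebra.ad ℝ (V n) X ^ k) ⁅X, v⁆))) t := by
  have h := HasDerivAt.fun_sum (u := Finset.range (N + 1)) fun k _ =>
    (hasDerivAt_pow k t).mul_const
      ((k.factorial : ℝ)⁻¹ * ξ ((LieAlgebra.ad ℝ (V n) X ^ k) v))
  refine h.congr_deriv ?_
  -- The index shift is exact: the lowest term on the left carries the factor `0`, the top term on
  -- the right carries `ad X ^ N = 0`.
  rw [Finset.sum_range_succ', Finset.sum_range_succ, hN]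
  simp only [LinearMap.zero_apply, map_zero, mul_zero, Nat.cast_zero, zero_mul, add_zero]
  refine Finset.sum_congr rfl fun k _ => ?_
  rw [pow_succ (LieAlgebra.ad ℝ (V n) X), Module.End.mul_apply, LieAlgebra.ad_apply,
    Nat.factorial_succ, Nat.add_sub_cancel]
  have h1 : (k : ℝ) + 1 ≠ 0 := by positivity
  have h2 : (k.factorial : ℝ) ≠ 0 := by positivity
  push_cast
  field_simp

/-- The functional `ξ ∘ e^{t ad X}`. -/
noncomputable def path {n : ℕ} (N : ℕ) (X : V n) (ξ : Module.Dual ℝ (V n)) (t : ℝ) :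
    Module.Dual ℝ (V n) :=
  ∑ k ∈ Finset.range (N + 1),
    (t ^ k * (k.factorial : ℝ)⁻¹) • ξ.comp (LieAlgebra.ad ℝ (V n) X ^ k)

theorem path_apply {n : ℕ} (N : ℕ) (X : V n) (ξ : Module.Dual ℝ (V n)) (t : ℝ) (v : V n) :
    path N X ξ t v = ∑ k ∈ Finset.range (N + 1),
      t ^ k * ((k.factorial : ℝ)⁻¹ * ξ ((LieAlgebra.ad ℝ (V n) X ^ k) v)) := by
  simp [path, LinearMap.sum_apply, mul_assoc]

theorem lie_e_right {n : ℕ} (X : V n) {j : ℕ} (hj : 1 ≤ j) :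
    ⁅X, e n j⁆ = ∑ i : Fin n, (X i * ((j : ℝ) - ((i : ℕ) + 1 : ℕ))) • e n (i + 1 + j) := by
  conv_lhs => rw [eq_sum_smul_e X]
  rw [sum_lie]
  refine Finset.sum_congr rfl fun i _ => ?_
  rw [smul_lie, lie_e _ _ _ (by omega) hj, smul_smul]

/-- The infinitesimal criterion for invariance of a polynomial. -/
theorem isCasimir_of_sum_eq_zero {n : ℕ} {F : MvPolynomial ℕ ℝ}
    (h : ∀ ξ : Module.Dual ℝ (V n), ∀ i, 1 ≤ i → i ≤ n →
      ∑ j ∈ Finset.Icc 1 n, ((j : ℝ) - i) * x n (i + j) ξ *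
        evalDual n (MvPolynomial.pderiv j F) ξ = 0) : IsCasimir n F := by
  have key : ∀ (X : V n) (ξ : Module.Dual ℝ (V n)),
      evalDual n F (ξ.comp (IsNilpotent.exp (LieAlgebra.ad ℝ (V n) X))) = evalDual n F ξ := by
    intro X ξ
    obtain ⟨N, hN⟩ := isNilpotent_ad n X
    have hd : ∀ t, HasDerivAt (fun r => evalDual n F (path N X ξ r)) 0 t := by
      intro t
      have h1 := MvPolynomial.hasDerivAt_eval
        (u := fun r j => x n j (path N X ξ r))
        (u' := fun j => path N X ξ t ⁅X, e n j⁆) (t := t) (S := Finset.Icc 1 n)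
        (fun j => by
          simp only [x, path_apply]
          exact hasDerivAt_sum_ad_pow hN ξ (e n j) t)
        (fun j hj => by
          rw [Finset.mem_Icc] at hj
          rw [e_eq_zero (by omega), lie_zero, map_zero]) F
      refine h1.congr_deriv ?_
      have h2 : ∀ j ∈ Finset.Icc 1 n, path N X ξ t ⁅X, e n j⁆ *
          MvPolynomial.eval (fun j => x n j (path N X ξ t)) (MvPolynomial.pderiv j F) =
          ∑ i : Fin n, X i * (((j : ℝ) - ((i : ℕ) + 1 : ℕ)) * x n (i + 1 + j) (path N X ξ t) *
            evalDual n (MvPolynomial.pderiv j F) (path N X ξ t)) := by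
        intro j hj
        rw [lie_e_right X (Finset.mem_Icc.mp hj).1, map_sum, Finset.sum_mul]
        refine Finset.sum_congr rfl fun i _ => ?_
        rw [map_smul, smul_eq_mul, evalDual, x]
        ring
      -- The derivative along the path is linear in `X`, so the hypothesis is applied to each `e_i`
      -- separately.
      rw [Finset.sum_congr rfl h2, Finset.sum_comm]
      refine Finset.sum_eq_zero fun i _ => ?_
      rw [← Finset.mul_sum, h _ _ (by omega) (by omega), mul_zero]
    have hc := is_const_of_deriv_eq_zero (fun t => (hd t).differentiableAt)
      (fun t => (hd t).deriv) 1 0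
    have h1 : path N X ξ 1 = ξ.comp (IsNilpotent.exp (LieAlgebra.ad ℝ (V n) X)) := by
      refine LinearMap.ext fun v => ?_
      rw [path_apply, LinearMap.comp_apply, exp_ad_apply (pow_eq_zero_of_le N.le_succ hN), map_sum]
      simp
    have h0 : path N X ξ 0 = ξ := by
      refine LinearMap.ext fun v => ?_
      rw [path_apply, Finset.sum_range_succ']
      simp
    rwa [h1, h0] at hc
  -- From the exponentials to the group they generate.
  have hg : ∀ g ∈ adjointGroup n, ∀ ξ : Module.Dual ℝ (V n),
      evalDual n F (ξ.comp (g : Module.End ℝ (V n))) = evalDual n F ξ := by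
    intro g hg
    induction hg using Subgroup.closure_induction with
    | mem g hg =>
      obtain ⟨X, hX⟩ := hg
      intro ξ
      rw [hX, key]
    | one => exact fun ξ => rfl
    | mul g k _ _ ihg ihk => exact fun ξ => (ihk (ξ.comp (g : Module.End ℝ (V n)))).trans (ihg ξ)
    | inv g _ ih =>
      intro ξ
      rw [← ih, LinearMap.comp_assoc]
      congr 1
      change ξ.comp (((g⁻¹ : LinearMap.GeneralLinearGroup ℝ (V n)) : Module.End ℝ (V n)) *
        (g : Module.End ℝ (V n))) = ξ
      rw [← Units.val_mul, inv_mul_cancel]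
      rfl
  intro ξ η hη
  obtain ⟨g, hg', rfl⟩ := mem_coadjointOrbit.mp hη
  exact hg g hg' ξ

/-- The vector `e_n` is central. -/
theorem x_eq_of_mem_coadjointOrbit {n : ℕ} {ξ η : Module.Dual ℝ (V n)}
    (h : η ∈ coadjointOrbit n ξ) : x n n η = x n n ξ := by
  have := isCasimir_of_sum_eq_zero (n := n) (F := MvPolynomial.X n) (fun ξ i hi _ =>
    Finset.sum_eq_zero fun j hj => by
      rcases eq_or_ne n j with rfl | hne
      · rw [x, e_eq_zero (by omega), map_zero, mul_zero, zero_mul]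
      · rw [MvPolynomial.pderiv_X_of_ne hne, evalDual, map_zero, mul_zero]) ξ η h
  simpa [evalDual] using this

/-! ### Normal forms for `x_n ≠ 0` -/

/-- On an orbit with `x_n ≠ 0` the coordinates `x_{n-i}` with `2i ≠ n` can be made zero. -/
theorem exists_mem_coadjointOrbit_forall_eq_zero {n : ℕ} {ξ : Module.Dual ℝ (V n)}
    (hξ : x n n ξ ≠ 0) (k : ℕ) (hk : k < n) : ∃ η ∈ coadjointOrbit n ξ,
      ∀ i, 1 ≤ i → i ≤ k → 2 * i ≠ n → x n (n - i) η = 0 := by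
  induction k with
  | zero => exact ⟨ξ, self_mem_coadjointOrbit ξ, fun i h1 h2 => by omega⟩
  | succ k ih =>
    obtain ⟨η, hη, h0⟩ := ih (by omega)
    by_cases hkn : 2 * (k + 1) = n
    · refine ⟨η, hη, fun i h1 h2 h3 => h0 i h1 ?_ h3⟩
      rcases eq_or_ne i (k + 1) with rfl | h4
      · exact absurd hkn h3
      · omega
    have hn : x n n η ≠ 0 := by rwa [x_eq_of_mem_coadjointOrbit hη]
    have hd : (n : ℝ) - 2 * (k + 1) ≠ 0 := by
      intro h
      apply hkn
      have : ((2 * (k + 1) : ℕ) : ℝ) = n := by push_cast; linarith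
      exact_mod_cast this
    -- The root of `x_{n-k-1} + t (n - 2(k+1)) x_n = 0`; the left side is the new value of
    -- `x_{n-k-1}` under `e^{t ad e_{k+1}}`.
    set t : ℝ := -(x n (n - (k + 1)) η) / (((n : ℝ) - 2 * (k + 1)) * x n n η) with ht
    refine ⟨_, coadjointOrbit_trans hη (comp_exp_ad_mem_coadjointOrbit η (t • e n (k + 1))), ?_⟩
    intro i h1 h2 h3
    rw [x, LinearMap.comp_apply]
    have hl : ⁅t • e n (k + 1), e n (n - i)⁆ =
        (t * (((n - i : ℕ) : ℝ) - ((k + 1 : ℕ) : ℝ))) • e n (k + 1 + (n - i)) := by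
      rw [smul_lie, lie_e _ _ _ (by omega) (by omega), smul_smul]
    rcases eq_or_ne i (k + 1) with rfl | hik
    · have hnn : k + 1 + (n - (k + 1)) = n := by omega
      rw [exp_ad_eq_add, hl, map_add, map_smul, hnn, Nat.cast_sub hk.le, smul_eq_mul]
      · change x n (n - (k + 1)) η + _ * x n n η = 0
        rw [ht]
        push_cast
        have h5 : (n : ℝ) - (k + 1) - (k + 1) = n - 2 * (k + 1) := by ring
        rw [h5]
        field_simp
        ring
      · rw [hl, hnn, lie_smul, smul_lie, lie_e _ _ _ (by omega) (by omega), e_eq_zero (by omega)]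
        simp
    -- For `i ≤ k` the bracket of `e_{k+1}` and `e_{n-i}` has degree above `n`, so the coordinates
    -- already cleared stay zero.
    · rw [exp_ad_eq_self]
      · exact h0 i h1 (by omega) h3
      · rw [hl, e_eq_zero (by omega), smul_zero]

/-! ### The hyperplane `x_n = 0` and the quotient algebra -/

theorem proj_exp_ad {n : ℕ} (X v : V (n + 1)) :
    proj n (IsNilpotent.exp (LieAlgebra.ad ℝ (V (n + 1)) X) v) =
      IsNilpotent.exp (LieAlgebra.ad ℝ (V n) (proj n X)) (proj n v) := by
  obtain ⟨N, hN⟩ := isNilpotent_ad (n + 1) X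
  obtain ⟨M, hM⟩ := isNilpotent_ad n (proj n X)
  -- Both exponentials are padded to `N + M` terms, so that they can be compared term by term.
  rw [exp_ad_apply (pow_eq_zero_of_le (Nat.le_add_right N M) hN),
    exp_ad_apply (pow_eq_zero_of_le (Nat.le_add_left M N) hM), map_sum]
  refine Finset.sum_congr rfl fun k hk => ?_
  rw [map_smul]
  congr 1
  clear hk
  induction k with
  | zero => rfl
  | succ k ih =>
    rw [pow_succ', pow_succ', Module.End.mul_apply, Module.End.mul_apply, LieAlgebra.ad_apply,
      LieAlgebra.ad_apply, LieHom.map_lie, ih]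

theorem proj_surjective (n : ℕ) : Function.Surjective (proj n) := by
  intro v
  refine ⟨fun k => if h : (k : ℕ) < n then v ⟨k, h⟩ else 0, ?_⟩
  ext k
  change (if h : (k.castSucc : ℕ) < n then v ⟨k.castSucc, h⟩ else 0) = v k
  simp

theorem proj_inv_apply {n : ℕ} {g : LinearMap.GeneralLinearGroup ℝ (V (n + 1))}
    {g' : LinearMap.GeneralLinearGroup ℝ (V n)}
    (h : ∀ v, proj n ((g : Module.End ℝ (V (n + 1))) v) = (g' : Module.End ℝ (V n)) (proj n v))
    (v : V (n + 1)) :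
    proj n (((g⁻¹ : LinearMap.GeneralLinearGroup ℝ (V (n + 1))) : Module.End ℝ (V (n + 1))) v) =
      ((g'⁻¹ : LinearMap.GeneralLinearGroup ℝ (V n)) : Module.End ℝ (V n)) (proj n v) := by
  have h1 : ∀ w, ((g'⁻¹ : LinearMap.GeneralLinearGroup ℝ (V n)) : Module.End ℝ (V n))
      ((g' : Module.End ℝ (V n)) w) = w := fun w => by
    rw [← Module.End.mul_apply, ← Units.val_mul, inv_mul_cancel]
    rfl
  have h2 : (g : Module.End ℝ (V (n + 1)))
      (((g⁻¹ : LinearMap.GeneralLinearGroup ℝ (V (n + 1))) : Module.End ℝ (V (n + 1))) v) = v := by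
    rw [← Module.End.mul_apply, ← Units.val_mul, mul_inv_cancel]
    rfl
  rw [← h1 (proj n _), ← h, h2]

theorem exists_adjointGroup_proj_eq {n : ℕ} {g : LinearMap.GeneralLinearGroup ℝ (V (n + 1))}
    (hg : g ∈ adjointGroup (n + 1)) : ∃ g' ∈ adjointGroup n, ∀ v,
      proj n ((g : Module.End ℝ (V (n + 1))) v) = (g' : Module.End ℝ (V n)) (proj n v) := by
  induction hg using Subgroup.closure_induction with
  | mem g hg =>
    obtain ⟨X, hX⟩ := hg
    obtain ⟨g', hg', h⟩ := exists_mem_adjointGroup (proj n X)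
    exact ⟨g', hg', fun v => by rw [hX, h, proj_exp_ad]⟩
  | one => exact ⟨1, one_mem _, fun v => rfl⟩
  | mul g k _ _ ihg ihk =>
    obtain ⟨g', hg', h⟩ := ihg
    obtain ⟨k', hk', h'⟩ := ihk
    exact ⟨g' * k', mul_mem hg' hk', fun v => (h _).trans (congrArg _ (h' v))⟩
  | inv g _ ih =>
    obtain ⟨g', hg', h⟩ := ih
    exact ⟨g'⁻¹, inv_mem hg', proj_inv_apply h⟩

/-- Generators lift because `proj` is surjective. With `exists_adjointGroup_proj_eq` this makes the
two groups act in the same way on the image of `embDual`. -/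
theorem exists_adjointGroup_lift {n : ℕ} {g' : LinearMap.GeneralLinearGroup ℝ (V n)}
    (hg' : g' ∈ adjointGroup n) : ∃ g ∈ adjointGroup (n + 1), ∀ v,
      proj n ((g : Module.End ℝ (V (n + 1))) v) = (g' : Module.End ℝ (V n)) (proj n v) := by
  induction hg' using Subgroup.closure_induction with
  | mem g' hg' =>
    obtain ⟨Y, hY⟩ := hg'
    obtain ⟨X, rfl⟩ := proj_surjective n Y
    obtain ⟨g, hg, h⟩ := exists_mem_adjointGroup X
    exact ⟨g, hg, fun v => by rw [hY, h, proj_exp_ad]⟩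
  | one => exact ⟨1, one_mem _, fun v => rfl⟩
  | mul g' k' _ _ ihg ihk =>
    obtain ⟨g, hg, h⟩ := ihg
    obtain ⟨k, hk, h'⟩ := ihk
    exact ⟨g * k, mul_mem hg hk, fun v => (h _).trans (congrArg _ (h' v))⟩
  | inv g' _ ih =>
    obtain ⟨g, hg, h⟩ := ih
    exact ⟨g⁻¹, inv_mem hg, proj_inv_apply h⟩

theorem coadjointOrbit_embDual {n : ℕ} (ζ : Module.Dual ℝ (V n)) :
    coadjointOrbit (n + 1) (embDual n ζ) = embDual n '' coadjointOrbit n ζ := by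
  ext η
  constructor
  · intro h
    obtain ⟨g, hg, rfl⟩ := mem_coadjointOrbit.mp h
    obtain ⟨g', hg', h'⟩ := exists_adjointGroup_proj_eq hg
    exact ⟨_, mem_coadjointOrbit.mpr ⟨g', hg', rfl⟩,
      LinearMap.ext fun v => congrArg ζ (h' v).symm⟩
  · rintro ⟨_, h, rfl⟩
    obtain ⟨g', hg', rfl⟩ := mem_coadjointOrbit.mp h
    obtain ⟨g, hg, h'⟩ := exists_adjointGroup_lift hg'
    exact mem_coadjointOrbit.mpr ⟨g, hg, LinearMap.ext fun v => congrArg ζ (h' v).symm⟩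

theorem proj_e {n i : ℕ} : proj n (e (n + 1) i) = e n i := by
  ext k
  rfl

theorem x_embDual {n i : ℕ} (ζ : Module.Dual ℝ (V n)) :
    x (n + 1) i (embDual n ζ) = x n i ζ :=
  congrArg ζ proj_e

theorem exists_embDual_eq {n : ℕ} {ξ : Module.Dual ℝ (V (n + 1))} (h : x (n + 1) (n + 1) ξ = 0) :
    ∃ ζ, embDual n ζ = ξ := by
  refine ⟨dualOf n fun i => x (n + 1) i ξ, ext_dual fun i h1 h2 => ?_⟩
  change x (n + 1) i _ = x (n + 1) i ξ
  rw [x_embDual]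
  rcases eq_or_ne i (n + 1) with rfl | hi
  · rw [h, x, e_eq_zero (by omega), map_zero]
  · exact dualOf_e _ h1 (by omega)

end V

/-! ### The binomial series and its differential equation -/

namespace V

/-- The coefficients of the binomial series of `(1 + t)^(-1/2)`. -/
noncomputable def invSqrtCoeff (j : ℕ) : ℝ :=
  (-1) ^ j * (∏ m ∈ Finset.range j, (2 * (m : ℝ) + 1)) / (2 ^ j * j.factorial)

theorem invSqrtCoeff_zero : invSqrtCoeff 0 = 1 := by simp [invSqrtCoeff]

theorem invSqrtCoeff_succ (j : ℕ) :
    2 * ((j : ℝ) + 1) * invSqrtCoeff (j + 1) = -(2 * j + 1) * invSqrtCoeff j := by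
  have h1 : (j : ℝ) + 1 ≠ 0 := by positivity
  have h2 : (j.factorial : ℝ) ≠ 0 := by positivity
  rw [invSqrtCoeff, invSqrtCoeff, Finset.prod_range_succ, Nat.factorial_succ]
  push_cast
  field_simp
  ring

section Series

variable {R : Type*} [CommRing R] [Algebra ℝ R]

open Polynomial

/-- The truncation `∑ c_j a^{q-j} P^j` of `a^q (1 + P / a)^(-1/2)`. -/
noncomputable def invSqrtSeries (a : R) (P : R[X]) (q : ℕ) : R[X] :=
  ∑ j ∈ Finset.range (q + 1), C (algebraMap ℝ R (invSqrtCoeff j) * a ^ (q - j)) * P ^ j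

/-- The differential equation `2 Q D' + Q' D = 0` of `D = Q^(-1/2)`, up to higher order terms. -/
theorem invSqrtSeries_ode (a : R) (P : R[X]) (q : ℕ) :
    2 * (C a + P) * derivative (invSqrtSeries a P q) + derivative P * invSqrtSeries a P q =
      C (algebraMap ℝ R ((2 * q + 1) * invSqrtCoeff q)) * P ^ q * derivative P := by
  induction q with
  | zero => simp [invSqrtSeries, invSqrtCoeff_zero]
  | succ q ih =>
    -- Raising `q` multiplies the old truncation by `a` and adds one term. The old error times `a`
    -- cancels against the new term by the recursion for `invSqrtCoeff`, leaving an error one power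
    -- of `P` higher.
    have hs : invSqrtSeries a P (q + 1) = C a * invSqrtSeries a P q +
        C (algebraMap ℝ R (invSqrtCoeff (q + 1))) * P ^ (q + 1) := by
      rw [invSqrtSeries, Finset.sum_range_succ, Nat.sub_self, pow_zero, mul_one, invSqrtSeries,
        Finset.mul_sum]
      congr 1
      refine Finset.sum_congr rfl fun j hj => ?_
      rw [Nat.sub_add_comm (by rw [Finset.mem_range] at hj; omega), pow_succ]
      simp only [C_mul]
      ring
    have h2 : C (algebraMap ℝ R 2) = 2 := by
      rw [map_ofNat, map_ofNat]
    have hc : C (algebraMap ℝ R ((2 * q + 1) * invSqrtCoeff q)) =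
        -(2 * ((q : R[X]) + 1) * C (algebraMap ℝ R (invSqrtCoeff (q + 1)))) := by
      have h : (2 * (q : ℝ) + 1) * invSqrtCoeff q =
          -(2 * ((q : ℝ) + 1) * invSqrtCoeff (q + 1)) := by
        linarith [invSqrtCoeff_succ q]
      rw [h]
      simp [h2]
    have hc' : C (algebraMap ℝ R ((2 * ((q + 1 : ℕ) : ℝ) + 1) * invSqrtCoeff (q + 1))) =
        (2 * ((q : R[X]) + 1) + 1) * C (algebraMap ℝ R (invSqrtCoeff (q + 1))) := by
      simp [h2]
    rw [hs, hc', derivative_add, derivative_C_mul, derivative_C_mul, derivative_pow]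
    rw [hc] at ih
    simp only [Nat.add_sub_cancel, map_natCast]
    push_cast
    linear_combination C a * ih

theorem coeff_X_mul_derivative {R : Type*} [CommRing R] (p : R[X]) (s : ℕ) :
    (X * derivative p).coeff s = s * p.coeff s := by
  cases s with
  | zero => simp
  | succ s =>
    rw [coeff_X_mul, coeff_derivative]
    push_cast
    ring

/-- This is the coefficient of `X^{m+1}` in `X` times the differential equation; the error term is
then divisible by `X^{q+1}` and does not reach this degree. -/
theorem sum_antidiagonal_invSqrtSeries (a : R) (P : R[X]) {q m : ℕ} (hm : m < q) :
    ∑ d ∈ Finset.HasAntidiagonal.antidiagonal (m + 1), (2 * (d.2 : R) + d.1) *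
      ((C a + X * P).coeff d.1 * (invSqrtSeries a (X * P) q).coeff d.2) = 0 := by
  have h := congrArg (fun p => (X * p).coeff (m + 1)) (invSqrtSeries_ode a (X * P) q)
  have h1 : X * (2 * (C a + X * P) * derivative (invSqrtSeries a (X * P) q) +
      derivative (X * P) * invSqrtSeries a (X * P) q) =
      2 * ((C a + X * P) * (X * derivative (invSqrtSeries a (X * P) q))) +
        (X * derivative (C a + X * P)) * invSqrtSeries a (X * P) q := by
    rw [derivative_add, derivative_C, zero_add]
    ring
  have h2 : X * (C (algebraMap ℝ R ((2 * q + 1) * invSqrtCoeff q)) * (X * P) ^ q *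
      derivative (X * P)) = X ^ (q + 1) * (C (algebraMap ℝ R ((2 * q + 1) * invSqrtCoeff q)) *
        P ^ q * derivative (X * P)) := by
    ring
  simp only [h1, h2] at h
  rw [coeff_X_pow_mul', if_neg (by omega), two_mul, coeff_add, coeff_add, coeff_mul,
    coeff_mul, ← Finset.sum_add_distrib, ← Finset.sum_add_distrib] at h
  rw [← h]
  refine Finset.sum_congr rfl fun d _ => ?_
  rw [coeff_X_mul_derivative, coeff_X_mul_derivative]
  ring

/-- The truncation of `2 a^{q+1} ((1 + P / a)^(1/2) - 1)`. -/
noncomputable def sqrtSeries (a : R) (P : R[X]) (q : ℕ) : R[X] :=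
  ∑ j ∈ Finset.range (q + 1),
    C (algebraMap ℝ R (invSqrtCoeff j / (j + 1)) * a ^ (q - j)) * P ^ (j + 1)

theorem map_sqrtSeries {S : Type*} [CommRing S] [Algebra ℝ S] (f : R →ₐ[ℝ] S) (a : R) (P : R[X])
    (q : ℕ) : (sqrtSeries a P q).map (f : R →+* S) = sqrtSeries (f a) (P.map (f : R →+* S)) q := by
  simp [sqrtSeries, Polynomial.map_sum]

end Series

/-! ### A solution of the recursion -/

open MvPolynomial

/-- The series `∑_{k ≤ q} x_{2q+1-k} t^k`. -/
noncomputable def coordSeries (q : ℕ) : Polynomial (MvPolynomial ℕ ℝ) :=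
  ∑ k ∈ Finset.range (q + 1), Polynomial.C (X (2 * q + 1 - k)) * Polynomial.X ^ k

theorem coeff_coordSeries (q s : ℕ) :
    (coordSeries q).coeff s = if s ≤ q then X (2 * q + 1 - s) else 0 := by
  rw [coordSeries, Polynomial.finsetSum_coeff]
  simp only [Polynomial.coeff_C_mul, Polynomial.coeff_X_pow, mul_ite, mul_one, mul_zero]
  rw [Finset.sum_ite_eq]
  simp

/-- The Casimir polynomial: up to normalization, the residue of the square root of the quadratic
differential `∑ x_k t^{-k-2} dt²`. -/
noncomputable def residue (q : ℕ) : MvPolynomial ℕ ℝ :=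
  (sqrtSeries (X (2 * q + 2)) (Polynomial.X * coordSeries q) q).coeff (q + 1)

/-- The chain rule: `a` is constant in `x_i`, and differentiating `P^{j+1}` cancels the denominator
`j + 1`, which turns `sqrtSeries` into `invSqrtSeries`. -/
theorem pderiv_residue {q i : ℕ} (hi : i ≠ 2 * q + 2) {P' : Polynomial (MvPolynomial ℕ ℝ)}
    (hP : ∀ s, pderiv i ((Polynomial.X * coordSeries q).coeff s) = P'.coeff s) :
    pderiv i (residue q) =
      (invSqrtSeries (X (2 * q + 2)) (Polynomial.X * coordSeries q) q * P').coeff (q + 1) := by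
  rw [residue, sqrtSeries, invSqrtSeries, Finset.sum_mul, Polynomial.finsetSum_coeff,
    Polynomial.finsetSum_coeff, map_sum]
  refine Finset.sum_congr rfl fun j _ => ?_
  have h0 : pderiv i (X (2 * q + 2) ^ (q - j) : MvPolynomial ℕ ℝ) = 0 := by
    rw [pderiv_pow, pderiv_X_of_ne hi.symm, mul_zero]
  rw [Polynomial.coeff_C_mul, pderiv_mul, algebraMap_eq, pderiv_C_mul, h0, mul_zero, zero_mul,
    zero_add, pderiv_coeff_pow_succ hP, mul_assoc (Polynomial.C _), Polynomial.coeff_C_mul,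
    mul_assoc ((j : Polynomial (MvPolynomial ℕ ℝ)) + 1)]
  have h1 : ((j : Polynomial (MvPolynomial ℕ ℝ)) + 1) =
      Polynomial.C (C ((j : ℝ) + 1)) := by simp
  rw [h1, Polynomial.coeff_C_mul, ← mul_assoc]
  congr 1
  have h2 : (j : ℝ) + 1 ≠ 0 := by positivity
  rw [mul_right_comm, ← C_mul, div_mul_cancel₀ _ h2]

/-- The variable `x_{q+1+s}` enters `P` only as the coefficient of `t^{q+1-s}`, so the chain rule
just shifts degrees. -/
theorem pderiv_residue_of_le {q s : ℕ} (hs : s ≤ q) : pderiv (q + 1 + s) (residue q) =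
    (invSqrtSeries (X (2 * q + 2)) (Polynomial.X * coordSeries q) q).coeff s := by
  rw [pderiv_residue (P' := Polynomial.X ^ (q + 1 - s)) (by omega), Polynomial.coeff_mul_X_pow',
    if_pos (by omega)]
  · congr 1
    omega
  · intro r
    rw [Polynomial.coeff_X_pow]
    cases r with
    | zero => rw [Polynomial.coeff_X_mul_zero, map_zero, if_neg (by omega)]
    | succ r =>
      rw [Polynomial.coeff_X_mul, coeff_coordSeries]
      by_cases h : r + s = q
      · rw [if_pos (by omega), if_pos (by omega), show 2 * q + 1 - r = q + 1 + s by omega,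
          pderiv_X_self]
      · rw [if_neg (show ¬ r + 1 = q + 1 - s by omega)]
        split_ifs
        · rw [pderiv_X_of_ne (by omega)]
        · exact map_zero _

theorem pderiv_residue_of_notMem {q i : ℕ} (hi : i ∉ Finset.Icc (q + 1) (2 * q + 2)) :
    pderiv i (residue q) = 0 := by
  rw [Finset.mem_Icc] at hi
  rw [pderiv_residue (P' := 0) (by omega), mul_zero, Polynomial.coeff_zero]
  intro r
  cases r with
  | zero => simp
  | succ r =>
    rw [Polynomial.coeff_X_mul, coeff_coordSeries, Polynomial.coeff_zero]
    split_ifs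
    · rw [pderiv_X_of_ne (by omega)]
    · exact map_zero _

theorem eval_residue (q : ℕ) (f : ℕ → ℝ) : eval f (residue q) =
    (sqrtSeries (f (2 * q + 2)) (Polynomial.X * (coordSeries q).map (eval f)) q).coeff (q + 1) := by
  have h := map_sqrtSeries (aeval f : MvPolynomial ℕ ℝ →ₐ[ℝ] ℝ) (X (2 * q + 2))
    (Polynomial.X * coordSeries q) q
  have h' : ((aeval f : MvPolynomial ℕ ℝ →ₐ[ℝ] ℝ) : MvPolynomial ℕ ℝ →+* ℝ) = eval f := by
    ext <;> simp
  rw [h', aeval_X, Polynomial.map_mul, Polynomial.map_X] at h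
  rw [residue, ← Polynomial.coeff_map, h]

theorem eval_residue_of_eq_zero {q : ℕ} {f : ℕ → ℝ} (hf : f (2 * q + 2) = 0) :
    eval f (residue q) = ((-1) ^ q * ∏ m ∈ Finset.range q, (2 * (m : ℝ) + 1)) /
      (2 ^ q * ((q + 1).factorial : ℝ)) * f (2 * q + 1) ^ (q + 1) := by
  -- With `a = 0` only `j = q` survives, and the lowest coefficient of `P^{q+1}` is
  -- `x_{2q+1}^{q+1}`.
  rw [eval_residue, hf, sqrtSeries, Finset.sum_range_succ, Finset.sum_eq_zero]
  · rw [zero_add, mul_pow, Polynomial.coeff_C_mul, Polynomial.coeff_X_pow_mul', if_pos le_rfl,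
      Nat.sub_self, Nat.sub_self, Polynomial.coeff_zero_eq_eval_zero, Polynomial.eval_pow,
      ← Polynomial.coeff_zero_eq_eval_zero, Polynomial.coeff_map, coeff_coordSeries,
      if_pos (Nat.zero_le _), eval_X, pow_zero, mul_one, Nat.sub_zero,
      invSqrtCoeff, Nat.factorial_succ]
    congr 1
    push_cast
    rw [div_div]
    congr 1
    ring
  · intro j hj
    rw [Finset.mem_range] at hj
    rw [zero_pow (by omega), mul_zero, map_zero, zero_mul]

theorem isF_residue (q : ℕ) : IsF q (residue q) where
  vars_subset i hi := by
    by_contra h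
    exact notMem_vars_of_pderiv_eq_zero (pderiv_residue_of_notMem h) hi
  constantCoeff_eq := by
    rw [← eval_zero, eval_residue_of_eq_zero rfl]
    simp
  pderiv_first := by
    have h := pderiv_residue_of_le (Nat.zero_le q)
    rw [add_zero] at h
    rw [h, invSqrtSeries, Finset.sum_range_succ', Polynomial.coeff_add,
      Polynomial.finsetSum_coeff, Finset.sum_eq_zero]
    · rw [pow_zero, mul_one, Polynomial.coeff_C_zero, invSqrtCoeff_zero, map_one, one_mul,
        zero_add, Nat.sub_zero]
    · intro j _
      rw [Polynomial.coeff_C_mul, mul_pow, Polynomial.coeff_X_pow_mul', if_neg (by omega),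
        mul_zero]
  pderiv_next m hm := by
    have h := sum_antidiagonal_invSqrtSeries (X (2 * q + 2)) (coordSeries q) hm
    -- The index becomes the degree `s = l - 1` in `D`, with weight `2s + (m + 1 - s) = l + m`. The
    -- split-off term `s = m + 1` is the left side of the recursion.
    rw [← Finset.Nat.sum_antidiagonal_swap, Finset.Nat.sum_antidiagonal_eq_sum_range_succ_mk,
      Finset.sum_range_succ] at h
    simp only [Prod.swap_prod_mk, Nat.sub_self, Polynomial.coeff_add, Polynomial.coeff_C_zero,
      Polynomial.coeff_X_mul_zero, add_zero, Nat.cast_zero] at h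
    have hD : pderiv (q + m + 2) (residue q) =
        (invSqrtSeries (X (2 * q + 2)) (Polynomial.X * coordSeries q) q).coeff (m + 1) := by
      have := pderiv_residue_of_le (Nat.succ_le_of_lt hm)
      rwa [show q + 1 + m.succ = q + m + 2 by omega] at this
    have hsum : ∑ l ∈ Finset.Icc 1 (m + 1), C ((l : ℝ) + (m : ℝ)) * X (2 * q + l - m) *
        pderiv (q + l) (residue q) = ∑ s ∈ Finset.range (m + 1), C (((s + 1 : ℕ) : ℝ) + (m : ℝ)) *
          X (2 * q + (s + 1) - m) * pderiv (q + (s + 1)) (residue q) :=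
      Finset.sum_nbij' (fun l => l - 1) (fun s => s + 1) (by simp) (by simp) (by simp; omega)
        (by simp) fun l hl => by
          rw [Nat.sub_add_cancel (Finset.mem_Icc.mp hl).1]
    rw [hD, hsum, eq_neg_iff_add_eq_zero, add_comm, ← h]
    refine congrArg₂ (· + ·) ?_ ?_
    · refine Finset.sum_congr rfl fun s hs => ?_
      rw [Finset.mem_range] at hs
      rw [show m + 1 - s = m - s + 1 by omega, Polynomial.coeff_C_succ, zero_add,
        Polynomial.coeff_X_mul, coeff_coordSeries, if_pos (by omega),
        show q + (s + 1) = q + 1 + s by ring, pderiv_residue_of_le (by omega),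
        show 2 * q + 1 - (m - s) = 2 * q + (s + 1) - m by omega, mul_assoc]
      congr 1
      rw [show m - s + 1 = m + 1 - s by omega, Nat.cast_sub (by omega)]
      simp only [map_add, map_natCast]
      push_cast
      ring
    · rw [mul_assoc]
      congr 1
      simp only [map_add, map_mul, map_natCast, map_ofNat]
      push_cast
      ring

/-! ### Arbitrary solutions: invariance and values on `x_{2q+2} = 0` -/

theorem sum_pderiv_eq_zero {q : ℕ} {F : MvPolynomial ℕ ℝ} (hF : IsF q F) {m : ℕ} (hm : m < q) :
    ∑ l ∈ Finset.Icc 1 (m + 2), C ((l : ℝ) + m) * X (2 * q + l - m) * pderiv (q + l) F = 0 := by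
  rw [Finset.sum_Icc_succ_top (by omega)]
  have h := hF.pderiv_next m hm
  rw [show 2 * q + (m + 1 + 1) - m = 2 * q + 2 by omega,
    show ((m + 1 + 1 : ℕ) : ℝ) + m = 2 * m + 2 by push_cast; ring,
    show q + (m + 1 + 1) = q + m + 2 by omega, h, add_neg_cancel]

/-- For `i ≤ q` the condition for `e_i` is `sum_pderiv_eq_zero` with `m = q - i` and `j = q + l`.
For `i > q` every term vanishes: only `j ≥ q + 1` matters, and then `i + j > 2q + 2` or `i = j = q +
1`. -/
theorem IsF.isCasimir {q : ℕ} {F : MvPolynomial ℕ ℝ} (hF : IsF q F) :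
    IsCasimir (2 * q + 2) F := by
  refine isCasimir_of_sum_eq_zero fun ξ i h1 h2 => ?_
  have hz : ∀ j ∈ Finset.Icc 1 (2 * q + 2), (j < q + 1 ∨ 2 * q + 2 < i + j ∨ i = j) →
      ((j : ℝ) - i) * x (2 * q + 2) (i + j) ξ * evalDual (2 * q + 2) (pderiv j F) ξ = 0 := by
    rintro j - (h | h | h)
    · rw [pderiv_eq_zero_of_notMem_vars, evalDual, map_zero, mul_zero]
      intro hj
      have := Finset.mem_Icc.mp (hF.vars_subset hj)
      omega
    · rw [x, e_eq_zero (by omega), map_zero, mul_zero, zero_mul]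
    · rw [h, sub_self, zero_mul, zero_mul]
  by_cases hi : i ≤ q
  · obtain ⟨m, rfl⟩ : ∃ m, q = i + m := ⟨q - i, by omega⟩
    have h := congrArg (fun p => evalDual (2 * (i + m) + 2) p ξ)
      (sum_pderiv_eq_zero hF (m := m) (by omega))
    simp only [evalDual, map_sum, map_mul, eval_C, eval_X, map_zero] at h
    rw [← Finset.sum_subset (s₁ := (Finset.Icc 1 (m + 2)).map (addLeftEmbedding (i + m)))]
    · rw [Finset.sum_map, ← h]
      refine Finset.sum_congr rfl fun l hl => ?_
      rw [addLeftEmbedding_apply, evalDual,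
        show 2 * (i + m) + l - m = i + (i + m + l) by omega]
      push_cast
      ring
    · intro j hj
      simp only [Finset.mem_map, Finset.mem_Icc, addLeftEmbedding_apply] at hj ⊢
      omega
    · intro j hj hj'
      refine hz j hj ?_
      by_contra hcon
      apply hj'
      simp only [Finset.mem_map, Finset.mem_Icc, addLeftEmbedding_apply] at hj ⊢
      exact ⟨j - (i + m), by omega, by omega⟩
  · exact Finset.sum_eq_zero fun j hj => hz j hj (by omega)

/-- Two choices of `F_{2q+2}` have the same partial derivatives in `x_{q+1}, …, x_{2q+1}`. -/
theorem IsF.pderiv_eq {q : ℕ} {F G : MvPolynomial ℕ ℝ} (hF : IsF q F) (hG : IsF q G) (s : ℕ)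
    (hs : s ≤ q) : pderiv (q + 1 + s) F = pderiv (q + 1 + s) G := by
  induction s using Nat.strong_induction_on with
  | _ s ih =>
    cases s with
    | zero => rw [add_zero, hF.pderiv_first, hG.pderiv_first]
    | succ m =>
      have h : C (2 * (m : ℝ) + 2) * X (2 * q + 2) * pderiv (q + m + 2) F =
          C (2 * (m : ℝ) + 2) * X (2 * q + 2) * pderiv (q + m + 2) G := by
        rw [hF.pderiv_next m hs, hG.pderiv_next m hs]
        congr 1
        refine Finset.sum_congr rfl fun l hl => ?_
        rw [Finset.mem_Icc] at hl
        have := ih (l - 1) (by omega) (by omega)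
        rw [show q + 1 + (l - 1) = q + l by omega] at this
        rw [this]
      have hne : C (2 * (m : ℝ) + 2) * X (2 * q + 2) ≠ (0 : MvPolynomial ℕ ℝ) :=
        mul_ne_zero (C_ne_zero.mpr (by positivity)) (X_ne_zero _)
      rw [show q + 1 + (m + 1) = q + m + 2 by omega]
      exact mul_left_cancel₀ hne h

/-- The difference `F - residue q` involves only `x_{2q+2}` and has no constant term, so it vanishes
on the hyperplane. -/
theorem IsF.evalDual_eq {q : ℕ} {F : MvPolynomial ℕ ℝ} (hF : IsF q F)
    {ξ : Module.Dual ℝ (V (2 * q + 2))} (hξ : x (2 * q + 2) (2 * q + 2) ξ = 0) :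
    evalDual (2 * q + 2) F ξ = ((-1) ^ q * ∏ m ∈ Finset.range q, (2 * (m : ℝ) + 1)) /
      (2 ^ q * ((q + 1).factorial : ℝ)) * x (2 * q + 2) (2 * q + 1) ξ ^ (q + 1) := by
  have hR := isF_residue q
  have hv : ∀ i ∈ (F - residue q).vars, x (2 * q + 2) i ξ = 0 := by
    intro i hi
    rcases eq_or_ne i (2 * q + 2) with rfl | hne
    · exact hξ
    · exfalso
      refine notMem_vars_of_pderiv_eq_zero ?_ hi
      rw [map_sub, sub_eq_zero]
      by_cases h : i ∈ Finset.Icc (q + 1) (2 * q + 2)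
      · rw [Finset.mem_Icc] at h
        have := hF.pderiv_eq hR (i - (q + 1)) (by omega)
        rwa [show q + 1 + (i - (q + 1)) = i by omega] at this
      · rw [pderiv_eq_zero_of_notMem_vars fun h' => h (hF.vars_subset h'),
          pderiv_eq_zero_of_notMem_vars fun h' => h (hR.vars_subset h')]
  have h0 : eval (fun i => x (2 * q + 2) i ξ) (F - residue q) = 0 := by
    rw [eval_eq_of_vars (g := 0) hv, eval_zero, map_sub, hF.constantCoeff_eq,
      hR.constantCoeff_eq, sub_zero]
  rw [map_sub, sub_eq_zero] at h0
  rw [evalDual, h0, eval_residue_of_eq_zero hξ]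

/-- Being affine in `x_{q+1}` with slope `x_{2q+2}^q`, `F` can be solved for `x_{q+1}` wherever
`x_{2q+2} ≠ 0`. -/
theorem IsF.exists_evalDual_eq {q : ℕ} {F : MvPolynomial ℕ ℝ} (hF : IsF q F) :
    ∃ G : MvPolynomial ℕ ℝ, q + 1 ∉ G.vars ∧ ∀ ξ : Module.Dual ℝ (V (2 * q + 2)),
      evalDual (2 * q + 2) F ξ = x (2 * q + 2) (2 * q + 2) ξ ^ q * x (2 * q + 2) (q + 1) ξ +
        evalDual (2 * q + 2) G ξ := by
  refine ⟨F - X (2 * q + 2) ^ q * X (q + 1), notMem_vars_of_pderiv_eq_zero ?_, fun ξ => ?_⟩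
  · rw [map_sub, hF.pderiv_first, pderiv_mul, pderiv_X_self, pderiv_pow,
      pderiv_X_of_ne (by omega)]
    ring
  · simp [evalDual]

/-! ### Classification of the orbits with `x_n ≠ 0` -/

theorem exists_mem_coadjointOrbit_normalForm {q : ℕ} {ξ : Module.Dual ℝ (V (2 * q + 2))}
    (hξ : x (2 * q + 2) (2 * q + 2) ξ ≠ 0) : ∃ η ∈ coadjointOrbit (2 * q + 2) ξ,
      ∀ i, i ≠ q + 1 → i ≠ 2 * q + 2 → x (2 * q + 2) i η = 0 := by
  obtain ⟨η, hη, h⟩ := exists_mem_coadjointOrbit_forall_eq_zero hξ (2 * q + 1) (by omega)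
  refine ⟨η, hη, fun i h1 h2 => ?_⟩
  by_cases hi : i = 0 ∨ 2 * q + 2 < i
  · rw [x, e_eq_zero hi, map_zero]
  · have := h (2 * q + 2 - i) (by omega) (by omega) (by omega)
    rwa [show 2 * q + 2 - (2 * q + 2 - i) = i by omega] at this

/-- Two points with equal invariants have the same normal form: `G` takes equal values on both
normal forms, so `F` forces their coordinates `x_{q+1}` to agree. -/
theorem IsF.coadjointOrbit_eq {q : ℕ} {F : MvPolynomial ℕ ℝ} (hF : IsF q F)
    {ξ : Module.Dual ℝ (V (2 * q + 2))} (hξ : x (2 * q + 2) (2 * q + 2) ξ ≠ 0) :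
    coadjointOrbit (2 * q + 2) ξ = {η | x (2 * q + 2) (2 * q + 2) η =
      x (2 * q + 2) (2 * q + 2) ξ ∧ evalDual (2 * q + 2) F η = evalDual (2 * q + 2) F ξ} := by
  ext η
  refine ⟨fun h => ⟨x_eq_of_mem_coadjointOrbit h, hF.isCasimir ξ η h⟩, fun ⟨h1, h2⟩ => ?_⟩
  obtain ⟨ξ', hξ', hz⟩ := exists_mem_coadjointOrbit_normalForm hξ
  obtain ⟨η', hη', hz'⟩ := exists_mem_coadjointOrbit_normalForm (h1 ▸ hξ)
  obtain ⟨G, hG, hFG⟩ := hF.exists_evalDual_eq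
  have hx : x (2 * q + 2) (2 * q + 2) η' = x (2 * q + 2) (2 * q + 2) ξ' := by
    rw [x_eq_of_mem_coadjointOrbit hη', x_eq_of_mem_coadjointOrbit hξ', h1]
  have hGe : evalDual (2 * q + 2) G η' = evalDual (2 * q + 2) G ξ' := by
    refine eval_eq_of_vars fun i hi => ?_
    rcases eq_or_ne i (2 * q + 2) with rfl | hne
    · exact hx
    · have : i ≠ q + 1 := fun h => hG (h ▸ hi)
      rw [hz i this hne, hz' i this hne]
  have he : evalDual (2 * q + 2) F η' = evalDual (2 * q + 2) F ξ' := by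
    rw [hF.isCasimir _ _ hη', hF.isCasimir _ _ hξ', h2]
  rw [hFG, hFG, hGe, hx, add_left_inj] at he
  have hx0 : x (2 * q + 2) (2 * q + 2) ξ' ≠ 0 := by rwa [x_eq_of_mem_coadjointOrbit hξ']
  have he' := mul_left_cancel₀ (pow_ne_zero q hx0) he
  have : η' = ξ' := ext_dual fun i _ _ => by
    change x (2 * q + 2) i η' = x (2 * q + 2) i ξ'
    rcases eq_or_ne i (2 * q + 2) with rfl | h3
    · exact hx
    rcases eq_or_ne i (q + 1) with rfl | h4
    · exact he'
    · rw [hz i h4 h3, hz' i h4 h3]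
  subst this
  exact coadjointOrbit_trans hξ' (coadjointOrbit_symm hη')

theorem IsF.exists_dual {q : ℕ} {F : MvPolynomial ℕ ℝ} (hF : IsF q F) {c : ℝ} (hc : c ≠ 0)
    (d : ℝ) : ∃ ξ : Module.Dual ℝ (V (2 * q + 2)), x (2 * q + 2) (2 * q + 2) ξ = c ∧
      evalDual (2 * q + 2) F ξ = d := by
  obtain ⟨G, hG, hFG⟩ := hF.exists_evalDual_eq
  let p : ℝ → Module.Dual ℝ (V (2 * q + 2)) := fun r =>
    dualOf (2 * q + 2) fun i => if i = 2 * q + 2 then c else if i = q + 1 then r else 0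
  have hp : ∀ r, x (2 * q + 2) (2 * q + 2) (p r) = c := fun r =>
    (dualOf_e _ (by omega) le_rfl).trans (if_pos rfl)
  have hp' : ∀ r, x (2 * q + 2) (q + 1) (p r) = r := fun r =>
    (dualOf_e _ (by omega) (by omega)).trans (by rw [if_neg (by omega), if_pos rfl])
  have hGp : ∀ r, evalDual (2 * q + 2) G (p r) = evalDual (2 * q + 2) G (p 0) := by
    intro r
    refine eval_eq_of_vars fun i hi => ?_
    by_cases h : i = 0 ∨ 2 * q + 2 < i
    · simp only [x, e_eq_zero h, map_zero]
    · have hi' : i ≠ q + 1 := fun h => hG (h ▸ hi)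
      simp only [x, p]
      rw [dualOf_e _ (by omega) (by omega), dualOf_e _ (by omega) (by omega), if_neg hi',
        if_neg hi']
  -- On the line `p` the function `F` equals `c^q r + G(p 0)`; this `r` gives it the value `d`.
  refine ⟨p ((d - evalDual (2 * q + 2) G (p 0)) / c ^ q), hp _, ?_⟩
  rw [hFG, hp, hp', hGp (_ / _), mul_div_cancel₀ _ (pow_ne_zero q hc), sub_add_cancel]

/-- For odd `n` the exception `2i = n` never occurs, so the normal form depends on `x_n` alone. -/
theorem coadjointOrbit_odd {q : ℕ} {ξ : Module.Dual ℝ (V (2 * q + 1))}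
    (hξ : x (2 * q + 1) (2 * q + 1) ξ ≠ 0) : coadjointOrbit (2 * q + 1) ξ =
      {η | x (2 * q + 1) (2 * q + 1) η = x (2 * q + 1) (2 * q + 1) ξ} := by
  ext η
  refine ⟨fun h => x_eq_of_mem_coadjointOrbit h, fun (h1 : _ = _) => ?_⟩
  obtain ⟨ξ', hξ', hz⟩ := exists_mem_coadjointOrbit_forall_eq_zero hξ (2 * q) (by omega)
  obtain ⟨η', hη', hz'⟩ :=
    exists_mem_coadjointOrbit_forall_eq_zero (h1 ▸ hξ) (2 * q) (by omega)
  have : η' = ξ' := ext_dual fun i h2 h3 => by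
    change x (2 * q + 1) i η' = x (2 * q + 1) i ξ'
    rcases eq_or_ne i (2 * q + 1) with rfl | h4
    · rw [x_eq_of_mem_coadjointOrbit hη', x_eq_of_mem_coadjointOrbit hξ', h1]
    · have h5 := hz (2 * q + 1 - i) (by omega) (by omega) (by omega)
      have h6 := hz' (2 * q + 1 - i) (by omega) (by omega) (by omega)
      rw [show 2 * q + 1 - (2 * q + 1 - i) = i by omega] at h5 h6
      rw [h5, h6]
  subst this
  exact coadjointOrbit_trans hξ' (coadjointOrbit_symm hη')

end V

theorem theorem2 :
    -- 1) `n = 2q + 2`, `x_n ≠ 0`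
    (∀ q : ℕ, (∃ F : MvPolynomial ℕ ℝ, V.IsF q F) ∧
      ∀ F : MvPolynomial ℕ ℝ, V.IsF q F →
        V.IsCasimir (2 * q + 2) F ∧
        (∀ ξ : Module.Dual ℝ (V (2 * q + 2)), V.x (2 * q + 2) (2 * q + 2) ξ = 0 →
          V.evalDual (2 * q + 2) F ξ =
            ((-1) ^ q * ∏ m ∈ Finset.range q, (2 * (m : ℝ) + 1)) /
              (2 ^ q * ((q + 1).factorial : ℝ)) *
              V.x (2 * q + 2) (2 * q + 1) ξ ^ (q + 1)) ∧
        {O : Set (Module.Dual ℝ (V (2 * q + 2))) | ∃ ξ : Module.Dual ℝ (V (2 * q + 2)),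
            V.x (2 * q + 2) (2 * q + 2) ξ ≠ 0 ∧ O = V.coadjointOrbit (2 * q + 2) ξ} =
          {O : Set (Module.Dual ℝ (V (2 * q + 2))) | ∃ c d : ℝ, c ≠ 0 ∧
            O = {η | V.x (2 * q + 2) (2 * q + 2) η = c ∧ V.evalDual (2 * q + 2) F η = d}}) ∧
    -- 2) `n = 2q + 1`, `x_n ≠ 0`
    (∀ q : ℕ,
      {O : Set (Module.Dual ℝ (V (2 * q + 1))) | ∃ ξ : Module.Dual ℝ (V (2 * q + 1)),
          V.x (2 * q + 1) (2 * q + 1) ξ ≠ 0 ∧ O = V.coadjointOrbit (2 * q + 1) ξ} =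
        {O : Set (Module.Dual ℝ (V (2 * q + 1))) | ∃ c : ℝ, c ≠ 0 ∧
          O = {η | V.x (2 * q + 1) (2 * q + 1) η = c}}) ∧
    -- 3) `x_n = 0`, where `n` is written as `n + 1`
    (∀ n : ℕ,
      {O : Set (Module.Dual ℝ (V (n + 1))) | ∃ ξ : Module.Dual ℝ (V (n + 1)),
          V.x (n + 1) (n + 1) ξ = 0 ∧ O = V.coadjointOrbit (n + 1) ξ} =
        {O : Set (Module.Dual ℝ (V (n + 1))) | ∃ ζ : Module.Dual ℝ (V n),
          O = V.embDual n '' V.coadjointOrbit n ζ}) := by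
  refine ⟨fun q => ⟨⟨V.residue q, V.isF_residue q⟩, fun F hF =>
    ⟨hF.isCasimir, fun ξ hξ => hF.evalDual_eq hξ, ?_⟩⟩, fun q => ?_, fun n => ?_⟩
  · ext O
    constructor
    · rintro ⟨ξ, hξ, rfl⟩
      exact ⟨_, _, hξ, hF.coadjointOrbit_eq hξ⟩
    · rintro ⟨c, d, hc, rfl⟩
      obtain ⟨ξ, rfl, rfl⟩ := hF.exists_dual hc d
      exact ⟨ξ, hc, (hF.coadjointOrbit_eq hc).symm⟩
  · ext O
    constructor
    · rintro ⟨ξ, hξ, rfl⟩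
      exact ⟨_, hξ, V.coadjointOrbit_odd hξ⟩
    · rintro ⟨c, hc, rfl⟩
      have h : V.x (2 * q + 1) (2 * q + 1) (V.dualOf (2 * q + 1) fun _ => c) = c :=
        V.dualOf_e _ (by omega) le_rfl
      have hξ : V.x (2 * q + 1) (2 * q + 1) (V.dualOf (2 * q + 1) fun _ => c) ≠ 0 := by rwa [h]
      refine ⟨_, hξ, ?_⟩
      rw [V.coadjointOrbit_odd hξ, h]
  · ext O
    constructor
    · rintro ⟨ξ, hξ, rfl⟩
      obtain ⟨ζ, rfl⟩ := V.exists_embDual_eq hξ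
      exact ⟨ζ, V.coadjointOrbit_embDual ζ⟩
    · rintro ⟨ζ, rfl⟩
      refine ⟨V.embDual n ζ, ?_, (V.coadjointOrbit_embDual ζ).symm⟩
      rw [V.x_embDual, V.x, V.e_eq_zero (by omega), map_zero]
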